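/- Let $G_2=\bigoplus_{n=1}^{\infty}\mathbb Z/2\mathbb Z$. A set $R\subseteq G_2$ is called a set of topological recurrence if, for every compact metric space $Y$, every action $(Q^g)_{g\in G_2}$ of $G_2$ on $Y$ by homeomorphisms that is minimal (every orbit is dense), and every nonempty open set $U\subseteq Y$, there is $g\in R$ with $U\cap Q^gU\neq\varnothing$. For every $\varepsilon>0$ there exist - a probability space $(X,\mu)$ and an action $T=(T^g)_{g\in G_2}$ of $G_2$ on $X$ by measurable maps preserving $\mu$, that is, $\mu(T^gE)=\mu(E)$ for every measurable $E\subseteq X$ and every $g\in G_2$, - a measurable set $D\subseteq X$ with $\mu(D)>\frac12-\varepsilon$, and - a set $S\subseteq G_2$ such that for every $h\in G_2$ the translate $S+h=\{s+h:s\in S\}$ is a set of topological recurrence, such that $D\cap T^gD=\varnothing$ for all $g\in S$. -/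

import Mathlib

open MeasureTheory
open scoped Pointwise

universe u v

/-- The group `G₂ = ⨁_{n} ℤ/2ℤ`, a direct sum of countably many copies of `ℤ/2ℤ`. -/
abbrev G2 : Type := DirectSum ℕ (fun _ => ZMod 2)

/-- `S ⊆ G` is a set of topological recurrence if for every minimal action of `G` by
homeomorphisms on a compact metric space `X` and every nonempty open `U ⊆ X` there is `g ∈ S` with
`U ∩ T^g U ≠ ∅`. Here `T^g x` is `g +ᵥ x`, so that `T^g U` is the image `g +ᵥ U`; minimality means
that every orbit is dense. -/
def IsSetOfTopologicalRecurrence {G : Type v} [AddCommGroup G] (S : Set G) : Prop :=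
  ∀ (X : Type u) [MetricSpace X] [CompactSpace X] [AddAction G X] [ContinuousConstVAdd G X]
    [AddAction.IsMinimal G X] (U : Set X), IsOpen U → U.Nonempty →
    ∃ g ∈ S, (U ∩ (g +ᵥ U)).Nonempty

/-! `S` is an increasing union of stages, each treating one pair `(k, h)`. A stage carries a finite
model: a subset `D` of a finite group, of density above `δ` and disjoint from its translates by the
stage. Passing to the next stage adds `h + r` for all nearly full 0-1 vectors `r` on a block of
fresh coordinates. Adding such an `r` cannot keep a vector light, nor keep it heavy, so `D × light ∪
(shifted D) × heavy` avoids the new elements; vectors of middling weight are a negligible loss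
(`HasFiniteModel.union_heavyBlockVecs`).

Recurrence comes from a Kneser-type theorem, `exists_disjoint_same_color`: two disjoint sets of one
colour nearly cover the block, and their indicators differ by a nearly full vector. Its proof is a
mod 2 Borsuk–Ulam argument on the cross-polytope. A weak limit of the models on `G2 → Bool` gives
the action. -/

/-! ### Mod 2 cochains on the cross-polytope -/

/-- A signed set is a pair `(F, A)` with `A ⊆ F`: the support, and the positive part. This is the
iterated cup product of the coboundaries of the sign functions `s i`, as a function on signed
sets. -/
def signedFlagSum (s : ℕ → Finset ℕ → Finset ℕ → ZMod 2) : ℕ → Finset ℕ → Finset ℕ → ZMod 2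
  | 0, _, _ => 1
  | i + 1, F, A => ∑ p ∈ F, s i (F.erase p) (A.erase p) * signedFlagSum s i (F.erase p) (A.erase p)

/-- A sign function that changes when a nonempty signed set is replaced by its antipode. -/
def IsAntipodal (s : Finset ℕ → Finset ℕ → ZMod 2) : Prop :=
  ∀ F A : Finset ℕ, F.Nonempty → A ⊆ F → s F (F \ A) = s F A + 1

/-- The coboundary squares to zero: swapping the two deletions pairs off the terms. -/
lemma sum_erase_erase_eq_zero (f : Finset ℕ → Finset ℕ → ZMod 2) (F A : Finset ℕ) :
    ∑ p ∈ F, ∑ q ∈ F.erase p, f ((F.erase p).erase q) ((A.erase p).erase q) = 0 := by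
  rw [Finset.sum_sigma']
  refine Finset.sum_involution (fun x _ => ⟨x.2, x.1⟩) ?_ ?_ ?_ ?_
  · rintro ⟨p, q⟩ _
    simp only [Finset.erase_right_comm (a := q) (b := p)]
    exact CharTwo.add_self_eq_zero _
  · rintro ⟨p, q⟩ h _ h'
    simp only [Finset.mem_sigma, Finset.mem_erase] at h
    simp only [Sigma.mk.injEq, heq_eq_eq] at h'
    exact h.2.1 h'.1
  · rintro ⟨p, q⟩ h
    simp only [Finset.mem_sigma, Finset.mem_erase] at h ⊢
    exact ⟨h.2.2, Ne.symm h.2.1, h.1⟩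
  · rintro ⟨p, q⟩ _
    rfl

/-- Cocycle condition: an edge has two ends when `i = 0`, and for larger `i` the cochain is a
coboundary. -/
lemma sum_signedFlagSum_erase (s : ℕ → Finset ℕ → Finset ℕ → ZMod 2) (i : ℕ) (F A : Finset ℕ)
    (hF : F.card = i + 2) :
    ∑ p ∈ F, signedFlagSum s i (F.erase p) (A.erase p) = 0 := by
  cases i with
  | zero =>
    simp only [signedFlagSum, Finset.sum_const, hF]
    decide
  | succ i =>
    simp only [signedFlagSum]
    exact sum_erase_erase_eq_zero (fun F A => s i F A * signedFlagSum s i F A) F A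

/-- The antipode adds 1 to every `s i`, which changes the sum by a cocycle sum, hence by zero. -/
lemma signedFlagSum_antipode {s : ℕ → Finset ℕ → Finset ℕ → ZMod 2} (hs : ∀ i, IsAntipodal (s i))
    (i : ℕ) (F A : Finset ℕ) (hF : F.card = i + 1) (hA : A ⊆ F) :
    signedFlagSum s i F (F \ A) = signedFlagSum s i F A := by
  induction i generalizing F A with
  | zero => rfl
  | succ i ih =>
    simp only [signedFlagSum]
    rw [← add_zero (∑ p ∈ F, s i (F.erase p) (A.erase p) * _),
      ← sum_signedFlagSum_erase s i F A hF, ← Finset.sum_add_distrib]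
    refine Finset.sum_congr rfl fun p hp => ?_
    have hc : (F.erase p).card = i + 1 := by rw [Finset.card_erase_of_mem hp, hF]; rfl
    have hsub : A.erase p ⊆ F.erase p := Finset.erase_subset_erase p hA
    have he : (F \ A).erase p = F.erase p \ A.erase p := by
      ext x; simp only [Finset.mem_erase, Finset.mem_sdiff]; tauto
    rw [he, ih _ _ hc hsub, hs i _ _ (Finset.card_pos.1 (by omega)) hsub]
    ring

lemma sum_powerset_erase_eq_zero (f : Finset ℕ → ZMod 2) {F : Finset ℕ} {p : ℕ} (hp : p ∈ F) :
    ∑ A ∈ F.powerset, f (A.erase p) = 0 := by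
  rw [← Finset.insert_erase hp, Finset.sum_powerset_insert (Finset.notMem_erase p F),
    ← Finset.sum_add_distrib]
  refine Finset.sum_eq_zero fun A hA => ?_
  have hpA : p ∉ A := fun h => Finset.notMem_erase p F (Finset.mem_powerset.1 hA h)
  rw [Finset.erase_insert hpA, Finset.erase_eq_of_notMem hpA]
  exact CharTwo.add_self_eq_zero _

/-- Stokes on the hemisphere where the last vertex is positive: the sum reduces to the equator,
where antipodal values of `s` add up to 1, leaving the same sum one dimension lower. Topologically,
the top power of the generator of `H¹(ℝPⁿ)` is nonzero. -/
lemma sum_signedFlagSum_eq_one {s : ℕ → Finset ℕ → Finset ℕ → ZMod 2}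
    (hs : ∀ i, IsAntipodal (s i)) (n : ℕ) :
    ∑ A ∈ (Finset.range n).powerset,
      signedFlagSum s n (Finset.range (n + 1)) (insert n A) = 1 := by
  induction n with
  | zero => simp [signedFlagSum]
  | succ n ih =>
    have hrange : (Finset.range (n + 2)).erase (n + 1) = Finset.range (n + 1) := by
      ext x; simp only [Finset.mem_erase, Finset.mem_range]; omega
    simp only [signedFlagSum]
    rw [Finset.sum_comm, Finset.sum_range_succ]
    rw [Finset.sum_eq_zero (s := Finset.range (n + 1)), zero_add]
    · have h1 : ∀ A ∈ (Finset.range (n + 1)).powerset,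
          (insert (n + 1) A).erase (n + 1) = A := fun A hA =>
        Finset.erase_insert fun h => by simpa using Finset.mem_powerset.1 hA h
      rw [hrange, Finset.sum_congr rfl fun A hA => by rw [h1 A hA], ← ih]
      set g : Finset ℕ → ZMod 2 := fun A =>
        s n (Finset.range (n + 1)) A * signedFlagSum s n (Finset.range (n + 1)) A
      have hn : n ∉ Finset.range n := by simp
      have h2 : ∑ A ∈ (Finset.range n).powerset, g A =
          ∑ A ∈ (Finset.range n).powerset, g (Finset.range n \ A) := by
        refine Finset.sum_bij' (fun A _ => Finset.range n \ A) (fun A _ => Finset.range n \ A)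
          ?_ ?_ ?_ ?_ ?_
        · intro A _; simp
        · intro A _; simp
        · intro A hA; simpa using Finset.mem_powerset.1 hA
        · intro A hA; simpa using Finset.mem_powerset.1 hA
        · intro A hA; rw [Finset.sdiff_sdiff_eq_self (Finset.mem_powerset.1 hA)]
      change ∑ A ∈ (Finset.range (n + 1)).powerset, g A = _
      rw [Finset.range_add_one, Finset.sum_powerset_insert hn, h2, ← Finset.sum_add_distrib]
      refine Finset.sum_congr rfl fun A hA => ?_
      have hA' := Finset.mem_powerset.1 hA
      have hsub : insert n A ⊆ Finset.range (n + 1) := by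
        rw [Finset.range_add_one]; exact Finset.insert_subset_insert n hA'
      have h3 : Finset.range n \ A = Finset.range (n + 1) \ insert n A := by
        ext x; simp only [Finset.mem_sdiff, Finset.mem_range, Finset.mem_insert]
        constructor
        · rintro ⟨h, h'⟩; exact ⟨by omega, by rintro (h | h); exacts [by omega, h' h]⟩
        · rintro ⟨h, h'⟩; push Not at h'; exact ⟨by omega, h'.2⟩
      simp only [g]
      rw [h3, signedFlagSum_antipode hs n _ _ (by simp) hsub, hs n _ _ (by simp) hsub,
        ← Finset.range_add_one, ← add_mul]
      rw [show ∀ a : ZMod 2, a + 1 + a = 1 by decide, one_mul]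
    -- A face off the equator lies in two facets of the hemisphere, so it cancels.
    · intro p hp
      have hpn : n + 1 ≠ p := by rintro rfl; simp at hp
      simp only [Finset.erase_insert_of_ne hpn]
      exact sum_powerset_erase_eq_zero (fun A =>
        s n ((Finset.range (n + 1 + 1)).erase p) (insert (n + 1) A) *
          signedFlagSum s n ((Finset.range (n + 1 + 1)).erase p) (insert (n + 1) A)) hp

/-- Otherwise `s i F A` factors out of the sum and leaves a vanishing cocycle sum. -/
lemma exists_erase_of_signedFlagSum_ne_zero {s : ℕ → Finset ℕ → Finset ℕ → ZMod 2} {i : ℕ}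
    {F A : Finset ℕ} (hF : F.card = i + 2) (h : signedFlagSum s (i + 1) F A ≠ 0) :
    ∃ p ∈ F, signedFlagSum s i (F.erase p) (A.erase p) ≠ 0 ∧
      s i (F.erase p) (A.erase p) ≠ s i F A := by
  by_contra! hcon
  apply h
  calc signedFlagSum s (i + 1) F A
      = ∑ p ∈ F, s i F A * signedFlagSum s i (F.erase p) (A.erase p) := by
        refine Finset.sum_congr rfl fun p hp => ?_
        by_cases h0 : signedFlagSum s i (F.erase p) (A.erase p) = 0
        · rw [h0, mul_zero, mul_zero]
        · rw [hcon p hp h0]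
    _ = 0 := by rw [← Finset.mul_sum, sum_signedFlagSum_erase s i F A hF, mul_zero]

/-! ### The colouring theorem -/

/-- The signed set `(F, A)` extends a signed set of support size `m` whose positive part has
colour `j`. -/
def ExtendsColor (c : Finset ℕ → ℕ) (m j : ℕ) (F A : Finset ℕ) : Prop :=
  ∃ F' ⊆ F, F'.card = m ∧ c (A ∩ F') = j

lemma exists_isAntipodal : ∃ s, IsAntipodal s := by
  classical
  refine ⟨fun F A => if h : F.Nonempty then (if F.min' h ∈ A then 0 else 1) else 0, ?_⟩
  intro F A hF _
  have := F.min'_mem hF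
  by_cases h : F.min' hF ∈ A <;> simp [hF, h, this]
  decide

lemma exists_isAntipodal_eq (P : Finset ℕ → Finset ℕ → Prop) :
    ∃ s, IsAntipodal s ∧ ∀ F A, P F A → ¬ P F (F \ A) → s F A = 0 := by
  classical
  obtain ⟨s, hs⟩ := exists_isAntipodal
  refine ⟨fun F A => if P F A ∧ ¬ P F (F \ A) then 0 else
    if P F (F \ A) ∧ ¬ P F A then 1 else s F A, ?_, ?_⟩
  · intro F A hF hA
    have := hs F A hF hA
    simp only [Finset.sdiff_sdiff_eq_self hA]
    by_cases h1 : P F A <;> by_cases h2 : P F (F \ A) <;> simp [h1, h2, this]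
    decide
  · intro F A h1 h2
    simp [h1, h2]

/-- If a colouring of the subsets of `{0, …, N - 1}` uses `k < N` colours, then two disjoint sets
of the same colour cover all but at most `3 * k` points. -/
theorem exists_disjoint_same_color (c : Finset ℕ → ℕ) (k N : ℕ) (hc : ∀ A, c A < k) (hk : k < N) :
    ∃ A B : Finset ℕ, A ⊆ Finset.range N ∧ B ⊆ Finset.range N ∧ Disjoint A B ∧ c A = c B ∧
      N ≤ A.card + B.card + 3 * k := by
  by_contra! hcon
  -- From size `m` up to `N` there are `k` steps, one for each colour.
  set m := N - k with hm
  have hexcl : ∀ F A j, F ⊆ Finset.range N → m ≤ F.card → A ⊆ F → ExtendsColor c m j F A →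
      ¬ ExtendsColor c m j F (F \ A) := by
    rintro F A j hF hFm hA ⟨F₁, h₁, h₁m, h₁c⟩ ⟨F₂, h₂, h₂m, h₂c⟩
    -- The two sets together have at least `2 * m - F.card ≥ N - 2 * k` points.
    have hdis : Disjoint (A ∩ F₁) ((F \ A) ∩ F₂) :=
      Finset.disjoint_sdiff.mono Finset.inter_subset_left Finset.inter_subset_left
    have h := hcon (A ∩ F₁) ((F \ A) ∩ F₂) ((Finset.inter_subset_right.trans h₁).trans hF)
      ((Finset.inter_subset_right.trans h₂).trans hF) hdis (by rw [h₁c, h₂c])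
    have hFN : F.card ≤ N := by simpa using Finset.card_le_card hF
    have e₁ := Finset.card_le_card (show A ⊆ (A ∩ F₁) ∪ (F \ F₁) by
      intro x hx; by_cases hx' : x ∈ F₁ <;> simp [hx, hx', hA hx])
    have e₂ := Finset.card_le_card (show F \ A ⊆ ((F \ A) ∩ F₂) ∪ (F \ F₂) by
      intro x hx; by_cases hx' : x ∈ F₂ <;> simp_all)
    have e₃ := Finset.card_union_le (A ∩ F₁) (F \ F₁)
    have e₄ := Finset.card_union_le ((F \ A) ∩ F₂) (F \ F₂)
    have e₅ := Finset.card_sdiff_add_card_eq_card h₁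
    have e₆ := Finset.card_sdiff_add_card_eq_card h₂
    have e₇ := Finset.card_sdiff_add_card_eq_card hA
    omega
  choose σ hσ hσ' using fun j => exists_isAntipodal_eq (ExtendsColor c m j)
  obtain ⟨n, rfl⟩ : ∃ n, N = n + 1 := ⟨N - 1, by omega⟩
  -- Below dimension `m - 1` the subtraction truncates to `σ 0`; only antipodality matters there.
  let s : ℕ → Finset ℕ → Finset ℕ → ZMod 2 := fun i => σ (i + 1 - m)
  have hs : ∀ i, IsAntipodal (s i) := fun i => hσ _
  have key : ∀ t F A, F ⊆ Finset.range (n + 1) → A ⊆ F → F.card = m + t →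
      signedFlagSum s (m + t - 1) F A ≠ 0 → ∃ F' ⊆ F, F'.card = m ∧ t ≤ c (A ∩ F') := by
    intro t
    induction t with
    | zero => intro F A _ _ hF _; exact ⟨F, subset_rfl, hF, Nat.zero_le _⟩
    | succ t ih =>
      intro F A hFN hA hF hne
      rw [show m + (t + 1) - 1 = (m + t - 1) + 1 by omega] at hne
      obtain ⟨p, hp, h1, h2⟩ := exists_erase_of_signedFlagSum_ne_zero (by omega) hne
      have hsub := Finset.erase_subset p F
      have hAsub : A.erase p ⊆ F.erase p := Finset.erase_subset_erase p hA
      have hcard : (F.erase p).card = m + t := by rw [Finset.card_erase_of_mem hp]; omega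
      obtain ⟨F', hF', hF'm, hF'c⟩ := ih _ _ (hsub.trans hFN) hAsub hcard h1
      have hinter : A.erase p ∩ F' = A ∩ F' := by
        ext x
        simp only [Finset.mem_inter, Finset.mem_erase]
        have : x ∈ F' → x ≠ p := fun hx => (Finset.mem_erase.1 (hF' hx)).1
        tauto
      refine ⟨F', hF'.trans hsub, hF'm, ?_⟩
      rw [hinter] at hF'c
      -- If the colour were exactly `t`, `σ t` would vanish on both signed sets, yet it differs on
      -- them.
      refine lt_of_le_of_ne hF'c fun heq => h2 ?_
      have e1 : ExtendsColor c m t (F.erase p) (A.erase p) :=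
        ⟨F', hF', hF'm, by rw [hinter, ← heq]⟩
      have e2 : ExtendsColor c m t F A := ⟨F', hF'.trans hsub, hF'm, heq.symm⟩
      simp only [s]
      rw [show m + t - 1 + 1 - m = t by omega,
        hσ' t _ _ e1 (hexcl _ _ _ (hsub.trans hFN) (by omega) hAsub e1),
        hσ' t _ _ e2 (hexcl _ _ _ hFN (by omega) hA e2)]
  have hone := sum_signedFlagSum_eq_one hs n
  obtain ⟨A, hA, hne⟩ := Finset.exists_ne_zero_of_sum_ne_zero (by rw [hone]; exact one_ne_zero)
  have hAsub : insert n A ⊆ Finset.range (n + 1) := by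
    rw [Finset.range_add_one]; exact Finset.insert_subset_insert n (Finset.mem_powerset.1 hA)
  obtain ⟨F', _, _, h⟩ := key k _ _ subset_rfl hAsub (by simp; omega)
    (by rwa [show m + k - 1 = n by omega])
  exact absurd (hc _) (not_lt.2 h)

/-! ### Weights of binary vectors -/

/-- A root-free form of `C(2l, l) / 4^l ≤ 1 / √(2l + 1)`: every single weight class has vanishing
density. -/
lemma centralBinom_sq_mul_le (l : ℕ) : l.centralBinom ^ 2 * (2 * l + 1) ≤ 16 ^ l := by
  induction l with
  | zero => simp
  | succ l ih =>
    have h := Nat.succ_mul_centralBinom_succ l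
    have h2 : (l + 1) ^ 2 * ((l + 1).centralBinom ^ 2 * (2 * (l + 1) + 1)) ≤
        (l + 1) ^ 2 * 16 ^ (l + 1) := by
      calc (l + 1) ^ 2 * ((l + 1).centralBinom ^ 2 * (2 * (l + 1) + 1))
          = ((l + 1) * (l + 1).centralBinom) ^ 2 * (2 * l + 3) := by ring
        _ = (l.centralBinom ^ 2 * (2 * l + 1)) * (4 * ((2 * l + 1) * (2 * l + 3))) := by
            rw [h]; ring
        _ ≤ 16 ^ l * (4 * (4 * (l + 1) ^ 2)) := by
            exact Nat.mul_le_mul ih (by nlinarith)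
        _ = (l + 1) ^ 2 * 16 ^ (l + 1) := by ring
    exact Nat.le_of_mul_le_mul_left h2 (by positivity)

/-- The number of nonzero entries of a vector over `ZMod 2`. -/
def weight {N : ℕ} (y : Fin N → ZMod 2) : ℕ := (Finset.univ.filter fun i => y i ≠ 0).card

lemma weight_add_le {N : ℕ} (x y : Fin N → ZMod 2) : weight (x + y) ≤ weight x + weight y := by
  classical
  refine (Finset.card_le_card ?_).trans (Finset.card_union_le _ _)
  intro i
  simp only [Finset.mem_filter, Finset.mem_univ, true_and, Finset.mem_union, Pi.add_apply]
  intro h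
  by_contra! h'
  exact h (by rw [h'.1, h'.2, add_zero])

/-- At most two of `a`, `b`, `a + b` are nonzero in `ZMod 2`. -/
lemma weight_add_weight_add_le {N : ℕ} (x y : Fin N → ZMod 2) :
    weight x + weight y + weight (x + y) ≤ 2 * N := by
  classical
  simp only [weight, Finset.card_filter]
  rw [← Finset.sum_add_distrib, ← Finset.sum_add_distrib]
  calc _ ≤ ∑ _i : Fin N, 2 := Finset.sum_le_sum fun i _ => by
        have : ∀ a b : ZMod 2, (if a ≠ 0 then 1 else 0) + (if b ≠ 0 then 1 else 0) +
            (if a + b ≠ 0 then 1 else 0) ≤ 2 := by decide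
        exact this (x i) (y i)
    _ = _ := by simp [mul_comm]

lemma card_weight_eq (N j : ℕ) :
    (Finset.univ.filter fun y : Fin N → ZMod 2 => weight y = j).card = N.choose j := by
  classical
  have h : N.choose j = (Finset.powersetCard j (Finset.univ : Finset (Fin N))).card := by simp
  rw [h]
  refine Finset.card_bij' (fun y _ => Finset.univ.filter fun i => y i ≠ 0)
    (fun s _ i => if i ∈ s then 1 else 0) ?_ ?_ ?_ ?_
  · intro y hy; simpa [weight, Finset.mem_powersetCard] using hy
  · intro s hs; simpa [weight, Finset.mem_powersetCard] using hs
  · intro y _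
    funext i
    have : ∀ a : ZMod 2, (if a ≠ 0 then (1 : ZMod 2) else 0) = a := by decide
    simpa using this (y i)
  · intro s _; ext i; simp

/-- All but an arbitrarily small proportion of the vectors over `ZMod 2` have weight at distance
more than `d` from half their length. -/
lemma exists_card_weight_near_half_le (d n₀ : ℕ) {η : ℝ} (hη : 0 < η) :
    ∃ N, n₀ ≤ N ∧ ((Finset.univ.filter fun y : Fin N → ZMod 2 =>
      N ≤ 2 * weight y + d ∧ 2 * weight y ≤ N + d).card : ℝ) ≤ η * 2 ^ N := by
  classical
  obtain ⟨q, hq⟩ := exists_nat_gt (((2 * d + 1 : ℕ) : ℝ) ^ 2 / η ^ 2)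
  set l := n₀ + q with hl
  refine ⟨2 * l, by omega, ?_⟩
  have hcard : (Finset.univ.filter fun y : Fin (2 * l) → ZMod 2 =>
      2 * l ≤ 2 * weight y + d ∧ 2 * weight y ≤ 2 * l + d).card ≤
      (2 * d + 1) * l.centralBinom := by
    calc _ ≤ ((Finset.Icc (l - d) (l + d)).biUnion fun j =>
          Finset.univ.filter fun y : Fin (2 * l) → ZMod 2 => weight y = j).card := by
          refine Finset.card_le_card fun y => ?_
          simp only [Finset.mem_filter, Finset.mem_univ, true_and, Finset.mem_biUnion,
            Finset.mem_Icc, exists_eq_right']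
          omega
      _ ≤ ∑ j ∈ Finset.Icc (l - d) (l + d), l.centralBinom := by
          refine Finset.card_biUnion_le.trans (Finset.sum_le_sum fun j _ => ?_)
          rw [card_weight_eq]
          exact Nat.choose_le_centralBinom j l
      _ ≤ _ := by
          rw [Finset.sum_const, smul_eq_mul, Nat.card_Icc]
          gcongr
          omega
  refine (Nat.cast_le.2 hcard).trans ?_
  refine le_of_sq_le_sq ?_ (by positivity)
  have h1 : ((l.centralBinom : ℝ)) ^ 2 * (2 * l + 1) ≤ 16 ^ l := by
    exact_mod_cast centralBinom_sq_mul_le l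
  have h2 : ((2 * d + 1 : ℕ) : ℝ) ^ 2 ≤ η ^ 2 * (2 * l + 1) := by
    rw [div_lt_iff₀ (by positivity)] at hq
    have : (q : ℝ) ≤ 2 * l + 1 := by rw [hl]; push_cast; nlinarith [Nat.cast_nonneg (α := ℝ) n₀, Nat.cast_nonneg (α := ℝ) q]
    nlinarith [sq_nonneg η]
  have h3 : ((2 : ℝ) ^ (2 * l)) ^ 2 = 16 ^ l := by
    rw [← pow_mul, mul_comm 2 l, mul_assoc, mul_comm l, pow_mul]; norm_num
  push_cast at h2 ⊢
  rw [mul_pow, mul_pow, h3]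
  calc _ ≤ η ^ 2 * (2 * l + 1) * (l.centralBinom : ℝ) ^ 2 := by gcongr
    _ = η ^ 2 * ((l.centralBinom : ℝ) ^ 2 * (2 * l + 1)) := by ring
    _ ≤ _ := by gcongr

/-! ### Finite models and their enlargement -/

lemma G2.add_self (g : G2) : g + g = 0 := by
  refine DFinsupp.ext fun i => ?_
  exact CharTwo.add_self_eq_zero (g i)

/-- The set `S` is not recurrent for a translation action of `G2` on a finite group, as witnessed
by a set of density greater than `δ`; the coordinates from `M` on act trivially. -/
def HasFiniteModel (δ : ℝ) (S : Set G2) (M : ℕ) : Prop :=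
  ∃ (F : Type) (_ : AddCommGroup F) (_ : Fintype F) (φ : G2 →+ F) (D : Finset F),
    (∀ g : G2, (∀ i < M, g i = 0) → φ g = 0) ∧ δ * Fintype.card F < D.card ∧
    ∀ g ∈ S, ∀ x ∈ D, x + φ g ∉ D

/-- The elements of `S` vanish from the coordinate `M` on. -/
def IsSupportedBelow (S : Set G2) (M : ℕ) : Prop := ∀ g ∈ S, ∀ i, M ≤ i → g i = 0

/-- Every colouring of `G2` with `k` colours has two points of the same colour whose difference
lies in `S + h`. -/
def IsColorRecurrent (k : ℕ) (h : G2) (S : Set G2) : Prop :=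
  ∀ c : G2 → ℕ, (∀ x, c x < k) → ∃ x, ∃ r ∈ S, c x = c (x + (r + h))

lemma HasFiniteModel.mono {δ : ℝ} {S : Set G2} {M M' : ℕ} (h : HasFiniteModel δ S M)
    (hM : M ≤ M') : HasFiniteModel δ S M' := by
  obtain ⟨F, i1, i2, φ, D, hφ, hD⟩ := h
  exact ⟨F, i1, i2, φ, D, fun g hg => hφ g fun i hi => hg i (hi.trans_le hM), hD⟩

/-- The coordinates `M, …, M + N - 1` of an element of `G2`. -/
def blockProj (M N : ℕ) : G2 →+ (Fin N → ZMod 2) where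
  toFun g i := g (M + i)
  map_zero' := rfl
  map_add' _ _ := rfl

lemma blockProj_apply (M N : ℕ) (g : G2) (i : Fin N) : blockProj M N g i = g (M + i) := rfl

/-- The element of `G2` which is the indicator function of `M + A`. -/
def blockVec (M : ℕ) (A : Finset ℕ) : G2 :=
  ∑ a ∈ A, DirectSum.of (fun _ => ZMod 2) (M + a) 1

lemma blockVec_apply (M : ℕ) (A : Finset ℕ) (i : ℕ) :
    blockVec M A i = if M ≤ i ∧ i - M ∈ A then 1 else 0 := by
  classical
  rw [blockVec, DFinsupp.finsetSum_apply]
  have : ∀ a ∈ A, (DirectSum.of (fun _ => ZMod 2) (M + a) 1 : G2) i =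
      if a = i - M then (if M ≤ i then 1 else 0) else 0 := by
    intro a _
    rw [DirectSum.of_apply]
    by_cases h : M + a = i
    · subst h; simp
    · rw [dif_neg h]
      split_ifs with h1 h2
      · omega
      · rfl
      · rfl
  rw [Finset.sum_congr rfl this, Finset.sum_ite_eq']
  by_cases h1 : M ≤ i <;> by_cases h2 : i - M ∈ A <;> simp [h1, h2]

lemma weight_blockProj_blockVec {M N : ℕ} {A : Finset ℕ} (hA : A ⊆ Finset.range N) :
    weight (blockProj M N (blockVec M A)) = A.card := by
  refine Finset.card_bij (fun i _ => (i : ℕ)) ?_ ?_ ?_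
  · intro i hi
    simpa [blockProj_apply, blockVec_apply] using hi
  · intro i _ j _ h; exact Fin.ext h
  · intro a ha
    exact ⟨⟨a, Finset.mem_range.1 (hA ha)⟩, by simpa [blockProj_apply, blockVec_apply] using ha, rfl⟩

/-- The block vectors whose support has at least `N - 3 * k` of the `N` possible elements. -/
def heavyBlockVecs (M N k : ℕ) : Set G2 :=
  {r | ∃ C ⊆ Finset.range N, N ≤ C.card + 3 * k ∧ r = blockVec M C}

lemma isColorRecurrent_heavyBlockVecs (M : ℕ) {N k : ℕ} (hk : k < N) (h : G2) :
    IsColorRecurrent k h ((fun r => h + r) '' heavyBlockVecs M N k) := by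
  classical
  intro c hc
  obtain ⟨A, B, hA, hB, hAB, hcAB, hcard⟩ :=
    exists_disjoint_same_color (fun A => c (blockVec M A)) k N (fun _ => hc _) hk
  refine ⟨blockVec M A, _, ⟨_, ⟨A ∪ B, Finset.union_subset hA hB, ?_, rfl⟩, rfl⟩, ?_⟩
  · rwa [Finset.card_union_of_disjoint hAB]
  · have hu : blockVec M (A ∪ B) = blockVec M A + blockVec M B := Finset.sum_union hAB
    have : blockVec M A + (h + blockVec M (A ∪ B) + h) = blockVec M B := by
      rw [hu, show blockVec M A + (h + (blockVec M A + blockVec M B) + h) =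
        (blockVec M A + blockVec M A) + (h + h) + blockVec M B by abel, G2.add_self, G2.add_self]
      simp
    simp only [this]
    exact hcAB

lemma HasFiniteModel.union_heavyBlockVecs {δ : ℝ} {S : Set G2} {M : ℕ} (hm : HasFiniteModel δ S M)
    (hS : IsSupportedBelow S M) {g₀ : G2} (hg₀ : g₀ ∈ S) {h : G2} (hh : ∀ i, M ≤ i → h i = 0)
    (k : ℕ) :
    ∃ N, k < N ∧
      HasFiniteModel δ (S ∪ (fun r => h + r) '' heavyBlockVecs M N k) (M + N) := by
  classical
  obtain ⟨F, i1, i2, φ, D, hφ, hδ, hD⟩ := hm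
  -- This `η` keeps `D.card * (1 - η)` above `δ * Fintype.card F`; the `+ 1` allows for empty `D`.
  obtain ⟨N, hkN, hN⟩ := exists_card_weight_near_half_le (3 * k) (k + 1)
    (η := (D.card - δ * Fintype.card F) / (D.card + 1)) (div_pos (by linarith) (by positivity))
  refine ⟨N, hkN, F × (Fin N → ZMod 2), inferInstance, inferInstance, φ.prod (blockProj M N),
    ?_⟩
  let L : Finset (Fin N → ZMod 2) := Finset.univ.filter fun y => 2 * weight y + 3 * k < N
  let H : Finset (Fin N → ZMod 2) := Finset.univ.filter fun y => N + 3 * k < 2 * weight y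
  -- The shift by `φ h` follows the new translation; the extra `φ g₀` makes the translated copy miss
  -- `D₁`, as `g₀ ∈ S`.
  let D₁ : Finset F := D.map (addRightEmbedding (φ h + φ g₀))
  have hLH : Disjoint L H := Finset.disjoint_left.2 fun y hL hH => by
    simp only [L, H, Finset.mem_filter] at hL hH; omega
  have hdisj : Disjoint (D ×ˢ L) (D₁ ×ˢ H) := Finset.disjoint_product.2 (Or.inr hLH)
  have hφφ : φ h + φ h = 0 := by rw [← map_add, G2.add_self, map_zero]
  refine ⟨(D ×ˢ L) ∪ (D₁ ×ˢ H), ?_, ?_, ?_⟩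
  · intro g hg
    refine Prod.ext (hφ g fun i hi => hg i (by omega)) (funext fun i => hg _ ?_)
    have := i.2
    omega
  · rw [Finset.card_union_of_disjoint hdisj, Finset.card_product, Finset.card_product,
      Finset.card_map, ← mul_add, Fintype.card_prod]
    set η : ℝ := (D.card - δ * Fintype.card F) / (D.card + 1) with hη
    set Z := Finset.univ.filter fun y : Fin N → ZMod 2 =>
      N ≤ 2 * weight y + 3 * k ∧ 2 * weight y ≤ N + 3 * k with hZ
    have htot : (2 : ℝ) ^ N ≤ L.card + H.card + Z.card := by
      have h1 : (Finset.univ : Finset (Fin N → ZMod 2)) ⊆ (L ∪ H) ∪ Z := by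
        intro y _
        simp only [L, H, Z, Finset.mem_union, Finset.mem_filter, Finset.mem_univ, true_and]
        omega
      have h2 := (Finset.card_le_card h1).trans ((Finset.card_union_le _ _).trans
        (Nat.add_le_add_right (Finset.card_union_le _ _) _))
      rw [Finset.card_univ] at h2
      simp only [Fintype.card_pi, ZMod.card, Finset.prod_const, Finset.card_univ,
        Fintype.card_fin] at h2
      exact_mod_cast h2
    have hηD : D.card * η < D.card - δ * Fintype.card F := by
      rw [hη, mul_div_assoc', div_lt_iff₀ (by positivity)]
      nlinarith
    have hc2 : (Fintype.card (Fin N → ZMod 2) : ℝ) = 2 ^ N := by simp [ZMod.card]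
    push_cast
    rw [hc2]
    have h2N : (0 : ℝ) < 2 ^ N := by positivity
    calc δ * (Fintype.card F * 2 ^ N) < (D.card * (1 - η)) * 2 ^ N := by
          rw [← mul_assoc]
          exact mul_lt_mul_of_pos_right (by linarith) h2N
      _ = D.card * (2 ^ N - η * 2 ^ N) := by ring
      _ ≤ D.card * (L.card + H.card) := by
          gcongr
          linarith
  · have hmem : ∀ x y, (x, y) ∈ (D ×ˢ L) ∪ (D₁ ×ˢ H) ↔
        (x ∈ D ∧ 2 * weight y + 3 * k < N) ∨
          (x - (φ h + φ g₀) ∈ D ∧ N + 3 * k < 2 * weight y) := by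
      intro x y
      simp [L, H, D₁, sub_eq_add_neg, ← eq_add_neg_iff_add_eq]
    rintro g (hg | ⟨_, ⟨C, hC, hCk, rfl⟩, rfl⟩) ⟨x, y⟩ hxy hxy'
    · have h0 : blockProj M N g = 0 := funext fun i => hS g hg _ (Nat.le_add_right _ _)
      rw [AddMonoidHom.prod_apply, h0, Prod.mk_add_mk, add_zero] at hxy'
      rw [hmem] at hxy hxy'
      rcases hxy with ⟨h1, h2⟩ | ⟨h1, h2⟩ <;> rcases hxy' with ⟨h3, h4⟩ | ⟨h3, h4⟩
      · exact hD g hg _ h1 h3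
      · omega
      · omega
      · refine hD g hg _ h1 ?_
        rwa [sub_add_eq_add_sub]
    · have h0 : blockProj M N h = 0 := funext fun i => hh _ (Nat.le_add_right _ _)
      have hr : φ (blockVec M C) = 0 := hφ _ fun i hi => by
        rw [blockVec_apply, if_neg (by omega)]
      have hw := weight_blockProj_blockVec (M := M) hC
      rw [AddMonoidHom.prod_apply, map_add, map_add, h0, hr, Prod.mk_add_mk, add_zero,
        zero_add] at hxy'
      generalize blockProj M N (blockVec M C) = r at hw hxy'
      have hyr : y + (y + r) = r := by
        rw [← add_assoc, show y + y = 0 from funext fun i => CharTwo.add_self_eq_zero (y i), zero_add]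
      have hle := weight_add_le y (y + r)
      have hle' := weight_add_weight_add_le y (y + r)
      rw [hyr] at hle hle'
      rw [hmem] at hxy hxy'
      -- Both light would bound the weight of `r` below `N - 3 * k`; both heavy would push the three
      -- weights past `2 * N`. The mixed cases contradict the choice of `g₀`.
      rcases hxy with ⟨h1, h2⟩ | ⟨h1, h2⟩ <;> rcases hxy' with ⟨h3, h4⟩ | ⟨h3, h4⟩
      · omega
      · refine hD g₀ hg₀ _ h3 ?_
        rwa [show x + φ h - (φ h + φ g₀) + φ g₀ = x by abel]
      · refine hD g₀ hg₀ _ h1 ?_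
        rwa [show x - (φ h + φ g₀) + φ g₀ = x + φ h - (φ h + φ h) by abel, hφφ, sub_zero]
      · omega

/-- A set with a finite model can be enlarged so that a given translate is colour recurrent for a
given number of colours. -/
lemma HasFiniteModel.exists_isColorRecurrent {δ : ℝ} {S : Set G2} {M : ℕ}
    (hm : HasFiniteModel δ S M) (hS : IsSupportedBelow S M) {g₀ : G2} (hg₀ : g₀ ∈ S) (h : G2)
    (k : ℕ) :
    ∃ S' M', S ⊆ S' ∧ HasFiniteModel δ S' M' ∧ IsSupportedBelow S' M' ∧
      IsColorRecurrent k h S' := by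
  classical
  obtain ⟨M₀, hM₀⟩ : ∃ M₀, ∀ i, M₀ ≤ i → h i = 0 := by
    refine ⟨(DFinsupp.support h).sup id + 1, fun i hi => ?_⟩
    by_contra hne
    have : i ≤ (DFinsupp.support h).sup id :=
      Finset.le_sup (f := id) (DFinsupp.mem_support_iff.2 hne)
    omega
  have hS' : IsSupportedBelow S (max M M₀) := fun g hg i hi => hS g hg i (le_of_max_le_left hi)
  have hh : ∀ i, max M M₀ ≤ i → h i = 0 := fun i hi => hM₀ i (le_of_max_le_right hi)
  obtain ⟨N, hkN, hN⟩ :=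
    (hm.mono (le_max_left M M₀)).union_heavyBlockVecs hS' hg₀ hh k
  refine ⟨_, _, Set.subset_union_left, hN, ?_, ?_⟩
  · rintro g (hg | ⟨_, ⟨C, hC, _, rfl⟩, rfl⟩) i hi
    · exact hS' g hg i (by omega)
    · have h1 : blockVec (max M M₀) C i = 0 := by
        rw [blockVec_apply, if_neg]
        rintro ⟨_, h2⟩
        have := Finset.mem_range.1 (hC h2)
        omega
      change h i + blockVec (max M M₀) C i = 0
      rw [h1, hh i (by omega), add_zero]
  · intro c hc
    obtain ⟨x, r, hr, hx⟩ := isColorRecurrent_heavyBlockVecs (max M M₀) hkN h c hc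
    exact ⟨x, r, Or.inr hr, hx⟩

/-- One point of `ℤ/2` has density `1/2`. Nonemptiness supplies the `g₀` needed for enlargement. -/
lemma exists_hasFiniteModel {δ : ℝ} (hδ : δ < 1 / 2) :
    ∃ S M, S.Nonempty ∧ HasFiniteModel δ S M ∧ IsSupportedBelow S M := by
  classical
  have hv : ∀ i, blockVec 0 {0} i = if i = 0 then 1 else 0 := by
    intro i; rw [blockVec_apply]; simp
  refine ⟨{blockVec 0 {0}}, 1, Set.singleton_nonempty _,
    ⟨Fin 1 → ZMod 2, inferInstance, inferInstance, blockProj 0 1, {0}, ?_, ?_, ?_⟩, ?_⟩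
  · intro g hg
    exact funext fun i => hg _ (by omega)
  · simp; linarith
  · rintro _ rfl x hx h
    rw [Finset.mem_singleton] at hx h
    have := congrFun h 0
    simp [hx, blockProj_apply, hv] at this
  · rintro _ rfl i hi
    rw [hv, if_neg (by omega)]

/-! ### Invariant measures on the shift space -/

open Filter Topology

instance : Countable G2 := inferInstanceAs (Countable (Π₀ _ : ℕ, ZMod 2))

/-- Configurations on `G2`, on which `G2` acts by shifts. -/
abbrev Config : Type := G2 → Bool

/-- The shift of configurations by an element of `G2`. -/
def shift (g : G2) (ω : Config) : Config := fun x => ω (x + g)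

lemma continuous_shift (g : G2) : Continuous (shift g) :=
  continuous_pi fun _ => continuous_apply _

/-- The shift action of `G2` on configurations. -/
abbrev shiftAction : AddAction G2 Config where
  vadd := shift
  zero_vadd ω := funext fun x => congrArg ω (add_zero x)
  add_vadd g g' ω := funext fun x => congrArg ω (add_assoc x g g').symm

instance : HasOuterApproxClosed Config := by
  let := TopologicalSpace.metrizableSpaceMetric Config
  infer_instance

lemma isClopen_setOf_apply_eq_true (g : G2) : IsClopen {ω : Config | ω g = true} :=
  (isClopen_discrete {true}).preimage (continuous_apply g)

/-- Each point of `F` is coded by its visits to `D`; the uniform measure is pushed forward along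
this coding. -/
lemma HasFiniteModel.exists_probabilityMeasure {δ : ℝ} {S : Set G2} {M : ℕ}
    (hm : HasFiniteModel δ S M) :
    ∃ μ : ProbabilityMeasure Config, (∀ g, (μ : Measure Config).map (shift g) = μ) ∧
      δ ≤ (μ {ω | ω 0 = true} : ℝ) ∧
      ∀ g ∈ S, μ ({ω | ω 0 = true} ∩ {ω | ω (-g) = true}) = 0 := by
  classical
  obtain ⟨F, i1, i2, φ, D, -, hδ, hD⟩ := hm
  let : MeasurableSpace F := ⊤
  let u : Measure F := ProbabilityTheory.uniformOn Set.univ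
  have : IsProbabilityMeasure u :=
    ProbabilityTheory.isProbabilityMeasure_uniformOn Set.finite_univ Set.univ_nonempty
  let Ψ : F → Config := fun x g => decide (x + φ g ∈ D)
  have hΨ : Measurable Ψ := measurable_from_top
  have : IsProbabilityMeasure (u.map Ψ) := Measure.isProbabilityMeasure_map hΨ.aemeasurable
  refine ⟨⟨u.map Ψ, inferInstance⟩, ?_, ?_, ?_⟩
  · intro g
    change (u.map Ψ).map (shift g) = u.map Ψ
    have htrans : u.map (fun x => x + φ g) = u := by
      ext s _
      rw [Measure.map_apply measurable_from_top MeasurableSpace.measurableSet_top, ProbabilityTheory.uniformOn_univ,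
        ProbabilityTheory.uniformOn_univ, measure_preimage_add_right]
    rw [Measure.map_map (continuous_shift g).measurable hΨ]
    conv_rhs => rw [← htrans, Measure.map_map hΨ measurable_from_top]
    congr 1
    funext x y
    simp only [Function.comp_apply, shift, Ψ, map_add]
    rw [show x + (φ y + φ g) = x + φ g + φ y by abel]
  · have hset : Ψ ⁻¹' {ω | ω 0 = true} = (D : Set F) := by
      ext x; simp [Ψ]
    change δ ≤ (u.map Ψ).real _
    rw [map_measureReal_apply hΨ (isClopen_setOf_apply_eq_true 0).isOpen.measurableSet, hset,
      measureReal_def, ProbabilityTheory.uniformOn_univ, Measure.count_apply_finset]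
    rw [ENNReal.toReal_div, ENNReal.toReal_natCast, ENNReal.toReal_natCast,
      le_div_iff₀ (by exact_mod_cast Fintype.card_pos)]
    exact hδ.le
  · intro g hg
    have hset : Ψ ⁻¹' ({ω | ω 0 = true} ∩ {ω | ω (-g) = true}) = ∅ := by
      rw [Set.eq_empty_iff_forall_notMem]
      intro x hx
      simp only [Set.mem_preimage, Set.mem_inter_iff, Set.mem_ofPred_eq, Ψ, decide_eq_true_eq,
        map_zero, add_zero, map_neg] at hx
      exact hD g hg _ hx.2 (by simpa using hx.1)
    refine (ProbabilityMeasure.null_iff_toMeasure_null _ _).2 ?_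
    change (u.map Ψ) _ = 0
    rw [Measure.map_apply hΨ ((isClopen_setOf_apply_eq_true 0).inter
      (isClopen_setOf_apply_eq_true (-g))).isOpen.measurableSet, hset, measure_empty]

/-- Passing to the limit along an increasing sequence of sets with finite models. -/
lemma exists_probabilityMeasure_iUnion {δ : ℝ} {S : ℕ → Set G2} (hS : Monotone S)
    (hm : ∀ n, ∃ M, HasFiniteModel δ (S n) M) :
    ∃ μ : ProbabilityMeasure Config, (∀ g, (μ : Measure Config).map (shift g) = μ) ∧
      δ ≤ (μ {ω | ω 0 = true} : ℝ) ∧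
      ∀ g ∈ ⋃ n, S n, μ ({ω | ω 0 = true} ∩ {ω | ω (-g) = true}) = 0 := by
  choose M hM using hm
  choose ν hν hδ h0 using fun n => (hM n).exists_probabilityMeasure
  let L : Ultrafilter ℕ := hyperfilter ℕ
  obtain ⟨μ, -, hμ⟩ := isCompact_univ.ultrafilter_le_nhds (L.map ν) (by simp)
  have hlim : Tendsto ν (L : Filter ℕ) (𝓝 μ) := hμ
  refine ⟨μ, fun g => ?_, ?_, fun g hg => ?_⟩
  · have h1 := ProbabilityMeasure.tendsto_map_of_tendsto_of_continuous ν μ hlim (continuous_shift g)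
    have h2 : ∀ n, (ν n).map (continuous_shift g).measurable.aemeasurable = ν n :=
      fun n => Subtype.ext (hν n g)
    simp only [h2] at h1
    exact congrArg (fun ρ : ProbabilityMeasure Config => (ρ : Measure Config))
      (tendsto_nhds_unique h1 hlim)
  -- Cylinder sets are clopen, so their measures pass to the weak limit.
  · have h1 := ProbabilityMeasure.tendsto_measure_of_isClopen_of_tendsto hlim
      (isClopen_setOf_apply_eq_true 0)
    exact ge_of_tendsto' ((NNReal.continuous_coe.tendsto _).comp h1) hδ
  · obtain ⟨n, hn⟩ := Set.mem_iUnion.1 hg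
    have h1 := ProbabilityMeasure.tendsto_measure_of_isClopen_of_tendsto hlim
      ((isClopen_setOf_apply_eq_true 0).inter (isClopen_setOf_apply_eq_true (-g)))
    refine tendsto_nhds_unique h1 (tendsto_const_nhds.congr' ?_)
    have : ∀ᶠ i in (L : Filter ℕ), n ≤ i :=
      (Nat.hyperfilter_le_atTop) (eventually_ge_atTop n)
    filter_upwards [this] with i hi
    exact (h0 i g (hS hi hn)).symm

/-! ### Topological recurrence and the final construction -/

/-- Recurrence for all finite colourings implies topological recurrence. -/
lemma isSetOfTopologicalRecurrence_of_isColorRecurrent {S : Set G2} {h : G2}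
    (hS : ∀ k, IsColorRecurrent k h S) :
    IsSetOfTopologicalRecurrence.{u} ((fun s => s + h) '' S) := by
  classical
  intro X _ _ _ _ _ U hU hne
  -- Finitely many translates of `U` cover `X`; group elements are coloured by the one containing
  -- their image of `x₀`.
  obtain ⟨I, hI⟩ := isCompact_univ.exists_finite_cover_vadd G2 hU hne
  obtain ⟨x₀, -⟩ := hne
  have hcov : ∀ y : X, ∃ i : I, y ∈ (i : G2) +ᵥ U := fun y => by
    obtain ⟨g, hg, hy⟩ := Set.mem_iUnion₂.1 (hI (Set.mem_univ y))
    exact ⟨⟨g, hg⟩, hy⟩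
  choose f hf using hcov
  obtain ⟨x, r, hr, hx⟩ := hS I.card (fun g => I.equivFin (f (g +ᵥ x₀))) fun _ => Fin.is_lt _
  have hfx : f (x +ᵥ x₀) = f ((x + (r + h)) +ᵥ x₀) := I.equivFin.injective (Fin.ext hx)
  have h1 := hf (x +ᵥ x₀)
  have h2 := hf ((x + (r + h)) +ᵥ x₀)
  rw [← hfx] at h2
  set g : G2 := (f (x +ᵥ x₀) : G2)
  rw [Set.mem_vadd_set_iff_neg_vadd_mem] at h1 h2
  refine ⟨r + h, ⟨r, hr, rfl⟩, _, h2, ?_⟩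
  rw [Set.mem_vadd_set_iff_neg_vadd_mem]
  convert h1 using 1
  simp only [vadd_vadd]
  congr 1
  abel

lemma IsColorRecurrent.mono {k : ℕ} {h : G2} {S S' : Set G2} (hS : IsColorRecurrent k h S)
    (hSS' : S ⊆ S') : IsColorRecurrent k h S' := fun c hc =>
  let ⟨x, r, hr, hx⟩ := hS c hc
  ⟨x, r, hSS' hr, hx⟩

lemma exists_monotone_hasFiniteModel {δ : ℝ} (hδ : δ < 1 / 2) :
    ∃ S : ℕ → Set G2, Monotone S ∧ (∀ n, ∃ M, HasFiniteModel δ (S n) M) ∧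
      ∀ k h, ∃ n, IsColorRecurrent k h (S n) := by
  classical
  let Stage := {p : Set G2 × ℕ // p.1.Nonempty ∧ HasFiniteModel δ p.1 p.2 ∧
    IsSupportedBelow p.1 p.2}
  have hstep : ∀ (p : Stage) (q : ℕ × G2), ∃ p' : Stage, p.1.1 ⊆ p'.1.1 ∧
      IsColorRecurrent q.1 q.2 p'.1.1 := by
    rintro ⟨⟨S, M⟩, ⟨g₀, hg₀⟩, hm, hS⟩ ⟨k, h⟩
    obtain ⟨S', M', hSS', hm', hS', hrec⟩ := hm.exists_isColorRecurrent hS hg₀ h k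
    exact ⟨⟨⟨S', M'⟩, ⟨g₀, hSS' hg₀⟩, hm', hS'⟩, hSS', hrec⟩
  choose next hnext hrec using hstep
  obtain ⟨S₀, M₀, h₀⟩ := exists_hasFiniteModel hδ
  obtain ⟨e, he⟩ := exists_surjective_nat (ℕ × G2)
  let stage : ℕ → Stage := fun n =>
    Nat.rec ⟨⟨S₀, M₀⟩, h₀⟩ (fun n p => next p (e n)) n
  refine ⟨fun n => (stage n).1.1, monotone_nat_of_le_succ fun n => hnext (stage n) (e n),
    fun n => ⟨_, (stage n).2.2.1⟩, fun k h => ?_⟩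
  obtain ⟨n, hn⟩ := he (k, h)
  refine ⟨n + 1, ?_⟩
  have hn' : IsColorRecurrent (e n).1 (e n).2 (stage (n + 1)).1.1 := hrec (stage n) (e n)
  rwa [hn] at hn'

theorem theorem1p3 (ε : ℝ) (hε : 0 < ε) :
    ∃ (X : Type) (_ : MeasurableSpace X) (μ : Measure X) (_ : IsProbabilityMeasure μ)
      (_ : AddAction G2 X) (_ : MeasurableConstVAdd G2 X) (_ : VAddInvariantMeasure G2 X μ)
      (D : Set X) (S : Set G2),
      MeasurableSet D ∧ 1 / 2 - ε < μ.real D ∧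
      (∀ g : G2, IsSetOfTopologicalRecurrence.{u} ((fun s => s + g) '' S)) ∧
      ∀ g ∈ S, D ∩ (g +ᵥ D) = ∅ := by
  -- The limit only preserves `≥ δ`; halving `ε` restores strictness.
  obtain ⟨S, hS, hm, hrec⟩ := exists_monotone_hasFiniteModel (δ := 1 / 2 - ε / 2) (by linarith)
  obtain ⟨μ, hμ, hδ, h0⟩ := exists_probabilityMeasure_iUnion hS hm
  let := shiftAction
  have hvadd : ∀ (g : G2) (ω : Config), g +ᵥ ω = shift g ω := fun _ _ => rfl
  let D₀ : Set Config := {ω | ω 0 = true}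
  let E : G2 → Set Config := fun g => D₀ ∩ {ω | ω (-g) = true}
  have hE : ∀ g, MeasurableSet (E g) := fun g => ((isClopen_setOf_apply_eq_true 0).inter
      (isClopen_setOf_apply_eq_true (-g))).isOpen.measurableSet
  -- The overlaps are only null in the limit; deleting countably many of them makes the
  -- intersections empty.
  have hnull : (μ : Measure Config) (⋃ g ∈ ⋃ n, S n, E g) = 0 :=
    (measure_biUnion_null_iff (Set.to_countable _)).2 fun g hg =>
      (ProbabilityMeasure.null_iff_toMeasure_null _ _).1 (h0 g hg)
  refine ⟨Config, inferInstance, μ, inferInstance, inferInstance,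
    ⟨fun g => (continuous_shift g).measurable⟩, ⟨fun g s hs => ?_⟩,
    D₀ \ ⋃ g ∈ ⋃ n, S n, E g, ⋃ n, S n, ?_, ?_, fun h => ?_, fun g hg => ?_⟩
  · conv_rhs => rw [← hμ g, Measure.map_apply (continuous_shift g).measurable hs]
    rfl
  · exact (isClopen_setOf_apply_eq_true 0).isOpen.measurableSet.diff
      (MeasurableSet.biUnion (Set.to_countable _) fun g _ => hE g)
  · rw [measureReal_def, measure_sdiff_null hnull]
    calc 1 / 2 - ε < 1 / 2 - ε / 2 := by linarith
      _ ≤ _ := hδ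
  · refine isSetOfTopologicalRecurrence_of_isColorRecurrent fun k => ?_
    obtain ⟨n, hn⟩ := hrec k h
    exact hn.mono (Set.subset_iUnion S n)
  · rw [Set.eq_empty_iff_forall_notMem]
    rintro ω ⟨⟨h1, h2⟩, h3⟩
    rw [Set.mem_vadd_set_iff_neg_vadd_mem, hvadd] at h3
    refine h2 (Set.mem_biUnion hg ⟨h1, ?_⟩)
    simpa [D₀, shift] using h3.1
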